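/- Let $(Y_{ij})_{i,j\ge 1}$ be iid real random variables with $E(Y_{11})=0$, $\mathrm{Var}(Y_{11})=\sigma^2>0$ and $E(|Y_{11}|^{4+\varepsilon})<\infty$ for some $\varepsilon>0$. For $n,m\in\mathbb N$ and $\mu:[0,1]^2\to\mathbb R$ let $$X_{ij}=\mu\left(\tfrac in,\tfrac jm\right)+Y_{ij},\qquad 1\le i\le n,\ 1\le j\le m .$$ Let $s_1,s_2\in(1/2,1)$ and let $l_n=l^{(1)}_n$, $l_m=l^{(2)}_m$ be integer block lengths of order $n^{s_1}$ and $m^{s_2}$, i.e. $l^{(1)}_n/n^{s_1}\to1$ as $n\to\infty$ and $l^{(2)}_m/m^{s_2}\to1$ as $m\to\infty$. Consider the sizes $(n,m)$ for which the grid is divided into complete blocks, i.e. $n=b_nl_n$ and $m=b_ml_m$ with integers $b_n,b_m$, and put $$\hat\mu_{hk}=\frac1{l_nl_m}\sum_{i=(h-1)l_n+1}^{hl_n}\ \sum_{j=(k-1)l_m+1}^{kl_m}X_{ij}\quad(1\le h\le b_n,\ 1\le k\le b_m),\qquad \bar X_{n,m}=\frac1{nm}\sum_{i=1}^n\sum_{j=1}^mX_{ij}.$$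 Let $N=nm$ and let $\hat\sigma=\hat\sigma_{n,m}$ be a weakly consistent estimator of $\sigma$ (that is, $\hat\sigma\to\sigma$ in probability as $N\to\infty$) with $\hat\sigma^2-\sigma^2=O_P(N^{-1/2})$. If $\mu$ is constant, then $$\frac1{\sqrt{2b_nb_m}}\left[\frac{l_nl_m}{\hat\sigma^2}\left(\sum_{h=1}^{b_n}\sum_{k=1}^{b_m}\hat\mu_{hk}^2-b_nb_m\bar X_{n,m}^2\right)-b_nb_m+1\right]\ \xrightarrow{\ \mathcal D\ }\ \mathcal N(0,1)\qquad\text{as }N\to\infty,$$ the limit being taken along the sizes $(n,m)$ described above. -/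

import Mathlib

open MeasureTheory ProbabilityTheory Filter Asymptotics
open scoped Topology NNReal ENNReal

namespace BlockTest

/-- The observations of the signal-plus-noise model on an `n × m` grid. Grid indices start at `0`,
so that `obs μ Y n m i j` is the observation with the 1-based index `(i + 1, j + 1)`,
`μ ((i + 1) / n, (j + 1) / m) + Y_{i + 1, j + 1}`. -/
noncomputable def obs {Ω : Type*} (μ : ℝ → ℝ → ℝ) (Y : ℕ × ℕ → Ω → ℝ) (n m i j : ℕ) (ω : Ω) : ℝ :=
  μ (((i : ℝ) + 1) / n) (((j : ℝ) + 1) / m) + Y (i, j) ω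

/-- The arithmetic mean of the observations in block `(h, k)` when all blocks have side lengths
`a × c`. The block indices `h`, `k` start at `0` as well. -/
noncomputable def blockMean {Ω : Type*} (X : ℕ → ℕ → Ω → ℝ) (a c h k : ℕ) (ω : Ω) : ℝ :=
  (1 / ((a : ℝ) * c)) *
    ∑ i ∈ Finset.Ico (h * a) ((h + 1) * a), ∑ j ∈ Finset.Ico (k * c) ((k + 1) * c), X i j ω

/-- The arithmetic mean of all observations on the `n × m` grid. -/
noncomputable def overallMean {Ω : Type*} (X : ℕ → ℕ → Ω → ℝ) (n m : ℕ) (ω : Ω) : ℝ :=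
  (1 / ((n : ℝ) * m)) * ∑ i ∈ Finset.range n, ∑ j ∈ Finset.range m, X i j ω

/-- The variance-based block statistic of an `n × m` sample `X`, for blocks of size `a × c`
arranged in `(n / a) × (m / c)` blocks, with the value `s` of the estimator of the standard
deviation. It is used only where `a ∣ n` and `c ∣ m`, so the quotients are exact. -/
noncomputable def varStat {Ω : Type*} (X : ℕ → ℕ → Ω → ℝ) (n m a c : ℕ) (s : ℝ) (ω : Ω) : ℝ :=
  let B : ℝ := ((n / a : ℕ) : ℝ) * ((m / c : ℕ) : ℝ)
  (1 / √(2 * B)) *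
    (((a : ℝ) * c / s ^ 2) *
        ((∑ h ∈ Finset.range (n / a), ∑ k ∈ Finset.range (m / c), blockMean X a c h k ω ^ 2)
          - B * overallMean X n m ω ^ 2)
      - B + 1)

/-- `N = n m → ∞` along those grid sizes `(n, m)` that are divided into complete blocks, i.e. for
which the block lengths `l₁ n` and `l₂ m` divide `n` and `m`. -/
def sizesToInfinity (l₁ l₂ : ℕ → ℕ) : Filter (ℕ × ℕ) :=
  comap (fun q : ℕ × ℕ => q.1 * q.2) atTop ⊓ 𝓟 {q : ℕ × ℕ | l₁ q.1 ∣ q.1 ∧ l₂ q.2 ∣ q.2}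

/-- The family `Z` is bounded in probability along the filter `F` (`Z = O_P(1)`). -/
def BoundedInProbability {Ω ι : Type*} [MeasurableSpace Ω] (P : Measure Ω) (Z : ι → Ω → ℝ)
    (F : Filter ι) : Prop :=
  ∀ δ : ℝ, 0 < δ → ∃ M : ℝ, ∀ᶠ q in F, P.real {ω | M < |Z q ω|} ≤ δ

end BlockTest

/-! When `μ` is constant its value cancels from the statistic. Write `a × c` for the block size, `B`
for the number of blocks and `s` for the value of the estimator. By `varStat_sub_eq`, the statistic
is exactly `σ² / s²` times `B^(-1/2) ∑ sqDev` plus three remainders. The estimation error of the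
variance contributes `(2ac)^(-1/2)` times an `O_P(1)` term, since `√B = √N / √(ac)`. The other two,
a constant and the overall mean, carry a factor `(2B)^(-1/2)`. Both `ac` and `B` tend to infinity,
so the remainders vanish in probability, and Slutsky's theorem handles the factor `σ² / s²`.

It remains to prove a central limit theorem for the iid variables `sqDev` of the blocks, whose law
changes with the block size (`tendstoInDistribution_sum_sqDev`). By the classical theorem each
`sqDev` converges in law to `(Z² - 1) / √2` with `Z` standard normal, and fourth moments of sums
show that its second moment tends to `1`, that of the limit. Convergence in law together with second
moments makes the squares uniformly integrable (`tendsto_integral_sq_mul_min`). This is Lindeberg's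
condition, and `tendsto_charFun_pow_of_lindeberg` concludes. -/

namespace BlockTest

/-! ### Lindeberg's theorem via characteristic functions -/

/-- Second order Taylor bound for `x ↦ exp (i x)`, both for small and for large `x`. -/
lemma norm_exp_mul_I_sub_taylor_two_le (x : ℝ) :
    ‖Complex.exp (x * Complex.I) - (1 + x * Complex.I - x ^ 2 / 2)‖ ≤ 4 * (x ^ 2 * min 1 |x|) := by
  rcases le_or_gt |x| 1 with hx | hx
  · have h := Complex.exp_bound (x := x * Complex.I) (by simpa using hx) (n := 3) (by norm_num)
    have e : ∑ m ∈ Finset.range 3, ((x : ℂ) * Complex.I) ^ m / m.factorial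
        = 1 + x * Complex.I - x ^ 2 / 2 := by
      simp [Finset.sum_range_succ, Nat.factorial, mul_pow]
      ring
    rw [e] at h
    refine h.trans ?_
    have e3 : |x| ^ 3 = x ^ 2 * |x| := by rw [← sq_abs x]; ring
    rw [min_eq_right hx]
    simp only [Complex.norm_mul, Complex.norm_real, Complex.norm_I, mul_one, Real.norm_eq_abs]
    have : 0 ≤ x ^ 2 * |x| := by positivity
    rw [e3]
    norm_num [Nat.factorial]
    linarith
  · rw [min_eq_left hx.le, ← sq_abs x]
    have h1 : ‖(1 + x * Complex.I - x ^ 2 / 2 : ℂ)‖ ≤ 1 + |x| + |x| ^ 2 / 2 := by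
      refine (norm_sub_le _ _).trans (add_le_add ((norm_add_le _ _).trans ?_) ?_)
      · simp
      · simp
    have h2 : ‖Complex.exp (x * Complex.I)‖ = 1 := Complex.norm_exp_ofReal_mul_I x
    refine (norm_sub_le _ _).trans ?_
    rw [h2]
    -- The constant `4` leaves room: `2 + |x| + x² / 2 ≤ 7/2 x²` for `|x| > 1`.
    nlinarith

variable {Ω : Type*} [MeasurableSpace Ω] {P : Measure Ω}

lemma integrable_sq_mul_min {X : Ω → ℝ} (hX : MemLp X 2 P) (c : ℝ) :
    Integrable (fun ω => X ω ^ 2 * min 1 |c * X ω|) P := by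
  refine hX.integrable_sq.mono ?_ (ae_of_all _ fun ω => ?_)
  · have := hX.1
    have h2 : AEStronglyMeasurable (fun ω => min 1 |c * X ω|) P :=
      (show Continuous fun x : ℝ => min 1 |c * x| by fun_prop).comp_aestronglyMeasurable this
    exact (this.pow 2).mul h2
  · rw [norm_mul]
    refine mul_le_of_le_one_right (norm_nonneg _) ?_
    rw [Real.norm_of_nonneg (le_min zero_le_one (abs_nonneg _))]
    exact min_le_left _ _

variable [IsProbabilityMeasure P]

/-- Second order expansion of the characteristic function with a Lindeberg type remainder. -/
lemma norm_charFun_sub_taylor_two_le {X : Ω → ℝ} (hX : MemLp X 2 P) (h0 : ∫ ω, X ω ∂P = 0)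
    (u : ℝ) :
    ‖charFun (P.map X) u - ((1 - u ^ 2 * (∫ ω, X ω ^ 2 ∂P) / 2 : ℝ) : ℂ)‖
      ≤ 4 * (u ^ 2 * ∫ ω, X ω ^ 2 * min 1 |u * X ω| ∂P) := by
  have hm : AEMeasurable X P := hX.1.aemeasurable
  have hi : Integrable X P := hX.integrable one_le_two
  have hi2 : Integrable (fun ω => X ω ^ 2) P := hX.integrable_sq
  have hcm : Continuous fun x : ℝ => Complex.exp ((u * x : ℝ) * Complex.I) := by fun_prop
  have he : Integrable (fun ω => Complex.exp ((u * X ω : ℝ) * Complex.I)) P :=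
    Integrable.of_bound (hcm.comp_aestronglyMeasurable hX.1) 1
      (ae_of_all _ fun ω => by rw [Complex.norm_exp_ofReal_mul_I])
  have hp : Integrable
      (fun ω => (1 + (u * X ω : ℝ) * Complex.I - ((u * X ω : ℝ) : ℂ) ^ 2 / 2 : ℂ)) P := by
    have a1 : Integrable (fun ω => (((u * X ω : ℝ)) : ℂ)) P := (hi.const_mul u).ofReal
    have a2 : Integrable (fun ω => ((((u * X ω) ^ 2 : ℝ)) : ℂ)) P := by
      have : Integrable (fun ω => (u * X ω) ^ 2) P := by
        simpa only [mul_pow] using hi2.const_mul (u ^ 2)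
      exact this.ofReal
    simp only [Complex.ofReal_pow] at a2
    exact ((integrable_const _).add (a1.mul_const _)).sub (a2.div_const 2)
  have h1 : charFun (P.map X) u = ∫ ω, Complex.exp ((u * X ω : ℝ) * Complex.I) ∂P := by
    rw [charFun_apply_real, integral_map hm (by fun_prop)]
    simp
  have h2 : ((1 - u ^ 2 * (∫ ω, X ω ^ 2 ∂P) / 2 : ℝ) : ℂ)
      = ∫ ω, (1 + (u * X ω : ℝ) * Complex.I - ((u * X ω : ℝ) : ℂ) ^ 2 / 2 : ℂ) ∂P := by
    have e : ∀ ω, (1 + (u * X ω : ℝ) * Complex.I - ((u * X ω : ℝ) : ℂ) ^ 2 / 2 : ℂ)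
        = ((1 - u ^ 2 / 2 * X ω ^ 2 : ℝ) : ℂ) + ((u * X ω : ℝ) : ℂ) * Complex.I := by
      intro ω; push_cast; ring
    simp_rw [e]
    rw [integral_add, integral_mul_const, integral_complex_ofReal, integral_complex_ofReal, integral_sub,
      integral_const_mul, integral_const_mul, h0]
    · simp; ring
    · exact integrable_const _
    · exact hi2.const_mul _
    · exact ((integrable_const _).sub (hi2.const_mul _)).ofReal
    · exact (hi.const_mul u).ofReal.mul_const _
  rw [h1, h2, ← integral_sub he hp, ← integral_const_mul, ← integral_const_mul]
  refine (norm_integral_le_integral_norm _).trans (integral_mono_of_nonneg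
    (ae_of_all _ fun _ => norm_nonneg _) (((integrable_sq_mul_min hX u).const_mul _).const_mul _)
    (ae_of_all _ fun ω => ?_))
  refine (norm_exp_mul_I_sub_taylor_two_le (u * X ω)).trans (le_of_eq ?_)
  ring

/-- Telescoping in the unit disc: the error of a product of `n` equal factors is at most `n` times
the error of one factor. -/
lemma norm_pow_sub_pow_le {z w : ℂ} (hz : ‖z‖ ≤ 1) (hw : ‖w‖ ≤ 1) (n : ℕ) :
    ‖z ^ n - w ^ n‖ ≤ n * ‖z - w‖ := by
  induction n with
  | zero => simp
  | succ n ih =>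
    have e : z ^ (n + 1) - w ^ (n + 1) = z ^ n * (z - w) + (z ^ n - w ^ n) * w := by ring
    rw [e]
    refine (norm_add_le _ _).trans ?_
    rw [norm_mul, norm_mul, norm_pow]
    have h1 : ‖z‖ ^ n ≤ 1 := pow_le_one₀ (norm_nonneg _) hz
    have h2 := mul_le_of_le_one_left (norm_nonneg (z - w)) h1
    have h3 := mul_le_of_le_one_right (norm_nonneg (z ^ n - w ^ n)) hw
    push_cast
    linarith

/-- The Lindeberg central limit theorem for rowwise iid arrays, in terms of characteristic
functions: row `i` has `B i` entries with the law of `X i`. -/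
theorem tendsto_charFun_pow_of_lindeberg {ι : Type*} {l : Filter ι} {X : ι → Ω → ℝ}
    (hX : ∀ i, MemLp (X i) 2 P) (h0 : ∀ᶠ i in l, ∫ ω, X i ω ∂P = 0)
    (h1 : Tendsto (fun i => ∫ ω, X i ω ^ 2 ∂P) l (𝓝 1)) {B : ι → ℕ} (hB : Tendsto B l atTop)
    (hL : Tendsto (fun i => ∫ ω, X i ω ^ 2 * min 1 |(√(B i))⁻¹ * X i ω| ∂P) l (𝓝 0)) (t : ℝ) :
    Tendsto (fun i => charFun (P.map (X i)) ((√(B i))⁻¹ * t) ^ B i) l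
      (𝓝 (Complex.exp (-(t ^ 2 / 2 : ℝ)))) := by
  have hBr : Tendsto (fun i => (B i : ℝ)) l atTop := tendsto_natCast_atTop_atTop.comp hB
  rw [tendsto_iff_norm_sub_tendsto_zero]
  have key : ∀ᶠ i in l,
      ‖charFun (P.map (X i)) ((√(B i))⁻¹ * t) ^ B i - Complex.exp (-(t ^ 2 / 2 : ℝ))‖
      ≤ 4 * (t ^ 2 * ((1 + |t|) * ∫ ω, X i ω ^ 2 * min 1 |(√(B i))⁻¹ * X i ω| ∂P))
        + (t ^ 2 / 2 * |(∫ ω, X i ω ^ 2 ∂P) - 1| + (t ^ 2 / 2) ^ 2 * (B i : ℝ)⁻¹) := by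
    filter_upwards [h0, hB.eventually_ge_atTop 1, hBr.eventually_ge_atTop (t ^ 2 / 2)]
      with i hi hBi hBt
    set b : ℝ := (B i : ℝ) with hb
    have hbpos : 0 < b := by rw [hb]; exact_mod_cast hBi
    set u : ℝ := (√b)⁻¹ * t with hu
    have hu2 : u ^ 2 = t ^ 2 / b := by
      rw [hu, mul_pow, inv_pow, Real.sq_sqrt hbpos.le]; ring
    set x : ℝ := t ^ 2 / 2 / b with hx
    have hx0 : 0 ≤ x := by positivity
    have hx1 : x ≤ 1 := by rw [hx, div_le_one hbpos]; exact hBt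
    set v := ∫ ω, X i ω ^ 2 ∂P with hv
    -- With `x = t² / (2b)` the limit is itself a `B i`-th power, so it suffices to compare single
    -- factors up to `o(1 / b)`.
    have hw : Complex.exp (-(t ^ 2 / 2 : ℝ)) = Complex.exp ((-x : ℝ)) ^ B i := by
      rw [← Complex.exp_nat_mul]
      congr 1
      have : (B i : ℝ) * (-x) = -(t ^ 2 / 2) := by rw [hx, ← hb]; field_simp
      exact_mod_cast this.symm
    have hnw : ‖Complex.exp ((-x : ℝ))‖ ≤ 1 := by
      rw [Complex.norm_exp_ofReal]; exact Real.exp_le_one_iff.2 (by linarith)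
    have : IsProbabilityMeasure (P.map (X i)) :=
      Measure.isProbabilityMeasure_map (hX i).1.aemeasurable
    rw [hw]
    refine (norm_pow_sub_pow_le (norm_charFun_le_one _) hnw _).trans ?_
    rw [← hb]
    have hA := norm_charFun_sub_taylor_two_le (hX i) hi u
    have hE : ‖((1 - u ^ 2 * v / 2 : ℝ) : ℂ) - Complex.exp ((-x : ℝ))‖
        ≤ x * |v - 1| + x ^ 2 := by
      rw [← Complex.ofReal_exp, ← Complex.ofReal_sub, Complex.norm_real, Real.norm_eq_abs]
      have e : 1 - u ^ 2 * v / 2 - Real.exp (-x)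
          = -(x * (v - 1)) + -(Real.exp (-x) - 1 - (-x)) := by
        rw [hu2, hx]; ring
      rw [e]
      refine (abs_add_le _ _).trans (add_le_add ?_ ?_)
      · rw [abs_neg, abs_mul, abs_of_nonneg hx0]
      · rw [abs_neg]
        have := Real.abs_exp_sub_one_sub_id_le (x := -x) (by rwa [abs_neg, abs_of_nonneg hx0])
        simpa using this
    -- The truncation scale is freed from `t` at the price of a factor `1 + |t|`, because `min 1
    -- (|t| y) ≤ (1 + |t|) min 1 y`.
    have hM : ∫ ω, X i ω ^ 2 * min 1 |u * X i ω| ∂P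
        ≤ (1 + |t|) * ∫ ω, X i ω ^ 2 * min 1 |(√b)⁻¹ * X i ω| ∂P := by
      rw [← integral_const_mul]
      refine integral_mono (integrable_sq_mul_min (hX i) u)
        ((integrable_sq_mul_min (hX i) _).const_mul _) fun ω => ?_
      have hy : min 1 |u * X i ω| ≤ (1 + |t|) * min 1 |(√b)⁻¹ * X i ω| := by
        have e : |u * X i ω| = |t| * |(√b)⁻¹ * X i ω| := by rw [← abs_mul, hu]; congr 1; ring
        rw [e]
        set y := |(√b)⁻¹ * X i ω|
        have hy0 : 0 ≤ y := abs_nonneg _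
        have ht0 := abs_nonneg t
        rcases le_total 1 y with h | h
        · rw [min_eq_left h]; exact (min_le_left _ _).trans (by linarith)
        · rw [min_eq_right h]; exact (min_le_right _ _).trans (by nlinarith)
      calc X i ω ^ 2 * min 1 |u * X i ω|
          ≤ X i ω ^ 2 * ((1 + |t|) * min 1 |(√b)⁻¹ * X i ω|) :=
            mul_le_mul_of_nonneg_left hy (sq_nonneg _)
        _ = _ := by ring
    calc b * ‖charFun (P.map (X i)) u - Complex.exp ((-x : ℝ))‖
        ≤ b * (4 * (u ^ 2 * ((1 + |t|) * ∫ ω, X i ω ^ 2 * min 1 |(√b)⁻¹ * X i ω| ∂P))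
            + (x * |v - 1| + x ^ 2)) := by
          refine mul_le_mul_of_nonneg_left ?_ hbpos.le
          refine (norm_sub_le_norm_sub_add_norm_sub _ ((1 - u ^ 2 * v / 2 : ℝ) : ℂ) _).trans
            (add_le_add (hA.trans ?_) hE)
          gcongr
      _ = _ := by
          rw [hu2, hx]; field_simp
  refine squeeze_zero' (Eventually.of_forall fun _ => norm_nonneg _) key ?_
  have l1 := ((hL.const_mul (1 + |t|)).const_mul (t ^ 2)).const_mul 4
  have l2 := ((h1.sub_const 1).abs).const_mul (t ^ 2 / 2)
  have l3 := (tendsto_inv_atTop_zero.comp hBr).const_mul ((t ^ 2 / 2) ^ 2)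
  have := l1.add (l2.add l3)
  simpa using this

end BlockTest

/-! ### Gaussian moments, uniform integrability, moments of sums -/

namespace BlockTest

/-- Read off from the fourth derivative at `0` of the moment generating function `exp (t² / 2)`. -/
lemma integral_pow_four_gaussianReal : ∫ x, x ^ 4 ∂(gaussianReal 0 1) = 3 := by
  have h : iteratedDeriv 4 (mgf (fun x ↦ x) (gaussianReal 0 1)) 0
      = ∫ x, x ^ 4 ∂(gaussianReal 0 1) := by
    rw [iteratedDeriv_mgf_zero] <;> simp
  rw [← h, mgf_fun_id_gaussianReal]
  have d0 (t : ℝ) : HasDerivAt (fun t : ℝ => Real.exp (t ^ 2 / 2)) (t * Real.exp (t ^ 2 / 2)) t := by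
    have := (((hasDerivAt_id t).pow 2).div_const 2).exp
    refine this.congr_deriv ?_
    simp; ring
  have e0 : (fun t : ℝ => Real.exp (0 * t + ((1 : ℝ≥0) : ℝ) * t ^ 2 / 2))
      = fun t => Real.exp (t ^ 2 / 2) := by
    ext t; simp
  have e1 : deriv (fun t : ℝ => Real.exp (t ^ 2 / 2)) = fun t => t * Real.exp (t ^ 2 / 2) :=
    funext fun t => (d0 t).deriv
  have e2 : deriv (fun t : ℝ => t * Real.exp (t ^ 2 / 2))
      = fun t => (t ^ 2 + 1) * Real.exp (t ^ 2 / 2) := by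
    ext t
    refine HasDerivAt.deriv (((hasDerivAt_id t).mul (d0 t)).congr_deriv ?_)
    simp; ring
  have e3 : deriv (fun t : ℝ => (t ^ 2 + 1) * Real.exp (t ^ 2 / 2))
      = fun t => (t ^ 3 + 3 * t) * Real.exp (t ^ 2 / 2) := by
    ext t
    refine HasDerivAt.deriv (((((hasDerivAt_id t).pow 2).add_const 1).mul (d0 t)).congr_deriv ?_)
    simp; ring
  have e4 : deriv (fun t : ℝ => (t ^ 3 + 3 * t) * Real.exp (t ^ 2 / 2))
      = fun t => (t ^ 4 + 6 * t ^ 2 + 3) * Real.exp (t ^ 2 / 2) := by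
    ext t
    refine HasDerivAt.deriv (((((hasDerivAt_id t).pow 3).add
      ((hasDerivAt_id t).const_mul 3)).mul (d0 t)).congr_deriv ?_)
    simp; ring
  rw [e0, iteratedDeriv_succ, iteratedDeriv_succ, iteratedDeriv_succ, iteratedDeriv_one,
    e1, e2, e3, e4]
  simp

lemma integral_sq_gaussianReal : ∫ x, x ^ 2 ∂(gaussianReal 0 1) = 1 := by
  have h := variance_fun_id_gaussianReal (μ := 0) (v := 1)
  rw [variance_eq_integral measurable_id'.aemeasurable] at h
  simpa using h

variable {Ω Ω' : Type*} [MeasurableSpace Ω] [MeasurableSpace Ω'] {P : Measure Ω} {P' : Measure Ω'}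
  [IsProbabilityMeasure P] [IsProbabilityMeasure P']

lemma MemLp.integrable_pow_of_le {X : Ω → ℝ} {n k : ℕ} (hX : MemLp X n P) (hk : k ≤ n) :
    Integrable (fun ω => X ω ^ k) P := by
  have h : MemLp X k P := hX.mono_exponent (by exact_mod_cast hk)
  have h2 := h.integrable_norm_pow'
  refine h2.mono (h.1.pow k) (ae_of_all _ fun ω => ?_)
  simp

/-- If `X i` converges in distribution together with its second moments, then the squares are
uniformly integrable in the sense of Lindeberg's condition. -/
theorem tendsto_integral_sq_mul_min {ι : Type*} {l : Filter ι} {X : ι → Ω → ℝ} {Z : Ω' → ℝ}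
    (hXZ : TendstoInDistribution X l Z (fun _ => P) P') (hX : ∀ i, MemLp (X i) 2 P)
    (hZ : MemLp Z 2 P')
    (h2 : Tendsto (fun i => ∫ ω, X i ω ^ 2 ∂P) l (𝓝 (∫ ω, Z ω ^ 2 ∂P')))
    {δ : ι → ℝ} (hδ : Tendsto δ l (𝓝 0)) :
    Tendsto (fun i => ∫ ω, X i ω ^ 2 * min 1 |δ i * X i ω| ∂P) l (𝓝 0) := by
  have hnn : ∀ (c x : ℝ), 0 ≤ x ^ 2 * min 1 |c * x| := fun c x =>
    mul_nonneg (sq_nonneg _) (le_min zero_le_one (abs_nonneg _))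
  have hlim (c : ℝ) (hc : 0 < c) : Tendsto (fun i => ∫ ω, X i ω ^ 2 * min 1 |c * X i ω| ∂P) l
      (𝓝 (∫ ω, Z ω ^ 2 * min 1 |c * Z ω| ∂P')) := by
    -- This function vanishes for `|x| ≥ 1 / c`, so it is bounded and its expectations converge by
    -- weak convergence. Subtracting them from the second moments gives the limit of the tail part.
    have gc : Continuous fun x : ℝ => x ^ 2 * (1 - min 1 |c * x|) := by fun_prop
    have gb (x : ℝ) : ‖x ^ 2 * (1 - min 1 |c * x|)‖ ≤ (c ^ 2)⁻¹ := by
      rcases le_total 1 |c * x| with h | h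
      · rw [min_eq_left h]; simp; positivity
      · rw [min_eq_right h, Real.norm_of_nonneg (mul_nonneg (sq_nonneg _) (by linarith))]
        have h3 : c ^ 2 * x ^ 2 ≤ 1 := by
          rw [← mul_pow, ← sq_abs]; exact pow_le_one₀ (abs_nonneg _) h
        have h4 : x ^ 2 ≤ (c ^ 2)⁻¹ := by
          rw [← one_div, le_div_iff₀ (by positivity)]; linarith
        refine le_trans (mul_le_of_le_one_right (sq_nonneg _) ?_) h4
        linarith [abs_nonneg (c * x)]
    let g := BoundedContinuousFunction.ofNormedAddCommGroup _ gc _ gb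
    have h3 := ProbabilityMeasure.tendsto_iff_forall_integral_tendsto.1 hXZ.tendsto g
    simp only [ProbabilityMeasure.coe_mk] at h3
    have e1 (i : ι) : ∫ ω, g ω ∂(P.map (X i))
        = ∫ ω, X i ω ^ 2 ∂P - ∫ ω, X i ω ^ 2 * min 1 |c * X i ω| ∂P := by
      rw [integral_map (hX i).1.aemeasurable g.continuous.aestronglyMeasurable,
        ← integral_sub (hX i).integrable_sq (integrable_sq_mul_min (hX i) c)]
      refine integral_congr_ae (ae_of_all _ fun ω => ?_)
      change X i ω ^ 2 * (1 - min 1 |c * X i ω|) = _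
      ring
    have e2 : ∫ ω, g ω ∂(P'.map Z)
        = ∫ ω, Z ω ^ 2 ∂P' - ∫ ω, Z ω ^ 2 * min 1 |c * Z ω| ∂P' := by
      rw [integral_map hZ.1.aemeasurable g.continuous.aestronglyMeasurable,
        ← integral_sub hZ.integrable_sq (integrable_sq_mul_min hZ c)]
      refine integral_congr_ae (ae_of_all _ fun ω => ?_)
      change Z ω ^ 2 * (1 - min 1 |c * Z ω|) = _
      ring
    simp_rw [e1, e2] at h3
    simpa using h2.sub h3
  have hZlim : Tendsto (fun n : ℕ => ∫ ω, Z ω ^ 2 * min 1 |((n : ℝ) + 1)⁻¹ * Z ω| ∂P') atTop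
      (𝓝 0) := by
    have hn : Tendsto (fun n : ℕ => ((n : ℝ) + 1)⁻¹) atTop (𝓝 0) := by
      simpa [one_div] using tendsto_one_div_add_atTop_nhds_zero_nat (𝕜 := ℝ)
    have := tendsto_integral_of_dominated_convergence (μ := P')
      (F := fun (n : ℕ) ω => Z ω ^ 2 * min 1 |((n : ℝ) + 1)⁻¹ * Z ω|) (f := fun _ => 0)
      (fun ω => Z ω ^ 2) (fun n => (integrable_sq_mul_min hZ _).1) hZ.integrable_sq
      (fun n => ae_of_all _ fun ω => by
        rw [Real.norm_of_nonneg (hnn _ _)]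
        exact mul_le_of_le_one_right (sq_nonneg _) (min_le_left _ _))
      (ae_of_all _ fun ω => by
        have hc : Continuous fun c : ℝ => Z ω ^ 2 * min 1 |c * Z ω| := by fun_prop
        simpa [Function.comp_def] using (hc.tendsto 0).comp hn)
    simpa using this
  rw [Metric.tendsto_nhds]
  intro η hη
  -- Fix a scale at which the tail of the limit is below `η`. Eventually `|δ i|` is smaller than
  -- this scale, and the integrand is monotone in it.
  obtain ⟨n, hn⟩ := (hZlim.eventually_lt_const hη).exists
  have hcpos : (0 : ℝ) < ((n : ℝ) + 1)⁻¹ := by positivity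
  filter_upwards [(hlim _ hcpos).eventually_lt_const hn,
    (Metric.tendsto_nhds.1 hδ) _ hcpos] with i hi hdi
  rw [Real.dist_eq, sub_zero] at hdi ⊢
  rw [abs_of_nonneg (integral_nonneg fun ω => hnn _ _)]
  refine lt_of_le_of_lt (integral_mono (integrable_sq_mul_min (hX i) _)
    (integrable_sq_mul_min (hX i) _) fun ω => ?_) hi
  refine mul_le_mul_of_nonneg_left (min_le_min_left _ ?_) (sq_nonneg _)
  rw [abs_mul, abs_mul, abs_of_pos hcpos]
  exact mul_le_mul_of_nonneg_right hdi.le (abs_nonneg _)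

/-- Moments up to order four of a sum of iid centred random variables. -/
theorem moments_sum {ι : Type*} {Y : ι → Ω → ℝ} (hm : ∀ p, Measurable (Y p)) (hind : iIndepFun Y P)
    (h4 : ∀ p, MemLp (Y p) 4 P) {v κ : ℝ} (e1 : ∀ p, ∫ ω, Y p ω ∂P = 0)
    (e2 : ∀ p, ∫ ω, Y p ω ^ 2 ∂P = v) (e4 : ∀ p, ∫ ω, Y p ω ^ 4 ∂P = κ) (s : Finset ι) :
    MemLp (fun ω => ∑ p ∈ s, Y p ω) 4 P ∧ ∫ ω, (∑ p ∈ s, Y p ω) ∂P = 0 ∧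
      ∫ ω, (∑ p ∈ s, Y p ω) ^ 2 ∂P = s.card * v ∧
      ∫ ω, (∑ p ∈ s, Y p ω) ^ 4 ∂P = s.card * κ + 3 * s.card * (s.card - 1) * v ^ 2 := by
  classical
  induction s using Finset.induction_on with
  | empty => simp
  | insert a s ha ih =>
    obtain ⟨i0, i1, i2, i4⟩ := ih
    set S : Ω → ℝ := fun ω => ∑ p ∈ s, Y p ω with hS
    have hSY : IndepFun S (Y a) P := by
      have := hind.indepFun_finsetSum_of_notMem hm ha
      convert this using 1
      ext ω; simp [hS]
    have iS (k : ℕ) (hk : k ≤ 4) : Integrable (fun ω => S ω ^ k) P :=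
      MemLp.integrable_pow_of_le (n := 4) i0 hk
    have iY (k : ℕ) (hk : k ≤ 4) : Integrable (fun ω => Y a ω ^ k) P :=
      MemLp.integrable_pow_of_le (n := 4) (h4 a) hk
    have hp (j k : ℕ) : IndepFun (fun ω => S ω ^ j) (fun ω => Y a ω ^ k) P :=
      hSY.comp (φ := fun x => x ^ j) (ψ := fun x => x ^ k) (by fun_prop) (by fun_prop)
    have iP (j k : ℕ) (hj : j ≤ 4) (hk : k ≤ 4) : Integrable (fun ω => S ω ^ j * Y a ω ^ k) P :=
      (hp j k).integrable_mul (iS j hj) (iY k hk)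
    have eP (j k : ℕ) (hj : j ≤ 4) (hk : k ≤ 4) :
        ∫ ω, S ω ^ j * Y a ω ^ k ∂P = (∫ ω, S ω ^ j ∂P) * ∫ ω, Y a ω ^ k ∂P :=
      (hp j k).integral_fun_mul_eq_mul_integral (iS j hj).1 (iY k hk).1
    have hs : ∀ ω, ∑ p ∈ insert a s, Y p ω = S ω + Y a ω := fun ω => by
      rw [Finset.sum_insert ha, add_comm]
    have i1' : ∫ ω, S ω ^ 1 ∂P = 0 := by simpa using i1
    have e1' : ∫ ω, Y a ω ^ 1 ∂P = 0 := by simpa using e1 a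
    have iS1 := iS 1 (by norm_num)
    have iY1 := iY 1 (by norm_num)
    simp only [pow_one] at iS1 iY1
    simp only [hs, Finset.card_insert_of_notMem ha]
    refine ⟨i0.add (h4 a), ?_, ?_, ?_⟩
    · rw [integral_add iS1 iY1, i1, e1, add_zero]
    · have e : ∀ ω, (S ω + Y a ω) ^ 2 = S ω ^ 2 + 2 * (S ω ^ 1 * Y a ω ^ 1) + Y a ω ^ 2 := by
        intro ω; ring
      simp_rw [e]
      have j1 := (iP 1 1 (by norm_num) (by norm_num)).const_mul 2
      rw [integral_add ((iS 2 (by norm_num)).fun_add j1) (iY 2 (by norm_num)),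
        integral_add (iS 2 (by norm_num)) j1, integral_const_mul,
        eP 1 1 (by norm_num) (by norm_num), i2, e2, e1']
      push_cast; ring
    -- Cross terms with a first power vanish by centring. The term `6 E[S²] E[Y²]` equals `6 k v²`
    -- for `k = s.card`, the increment of `3 k (k - 1) v²`.
    · have e : ∀ ω, (S ω + Y a ω) ^ 4 = S ω ^ 4 + 4 * (S ω ^ 3 * Y a ω ^ 1)
          + 6 * (S ω ^ 2 * Y a ω ^ 2) + 4 * (S ω ^ 1 * Y a ω ^ 3) + Y a ω ^ 4 := by
        intro ω; ring
      simp_rw [e]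
      have j1 := (iP 3 1 (by norm_num) (by norm_num)).const_mul 4
      have j2 := (iP 2 2 (by norm_num) (by norm_num)).const_mul 6
      have j3 := (iP 1 3 (by norm_num) (by norm_num)).const_mul 4
      have j0 := iS 4 le_rfl
      rw [integral_add (((j0.fun_add j1).fun_add j2).fun_add j3) (iY 4 le_rfl),
        integral_add ((j0.fun_add j1).fun_add j2) j3, integral_add (j0.fun_add j1) j2, integral_add j0 j1,
        integral_const_mul, integral_const_mul, integral_const_mul,
        eP 3 1 (by norm_num) (by norm_num), eP 2 2 (by norm_num) (by norm_num),
        eP 1 3 (by norm_num) (by norm_num), i1', e1', i2, i4, e2, e4]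
      push_cast; ring

end BlockTest

/-! ### Independent blocks and the limit theorem for their squared sums -/

namespace BlockTest

variable {Ω : Type*} [MeasurableSpace Ω] {P : Measure Ω}

/-- A function of the coordinates in `S` factors through restriction to `S`, with extension by zero
as a section. Independence of the two subfamilies over `S` and `T` therefore passes to `F` and `G`.
-/
lemma indepFun_of_dependsOn {ι : Type*} {Y : ι → Ω → ℝ} (hm : ∀ p, Measurable (Y p))
    (hind : iIndepFun Y P) {S T : Finset ι} (hST : Disjoint S T) {F G : (ι → ℝ) → ℝ}
    (hF : Measurable F) (hG : Measurable G) (hFS : DependsOn F S) (hGT : DependsOn G T) :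
    IndepFun (fun ω => F fun p => Y p ω) (fun ω => G fun p => Y p ω) P := by
  classical
  let ext (S : Finset ι) (x : S → ℝ) (i : ι) : ℝ := if h : i ∈ S then x ⟨i, h⟩ else 0
  have hext (S : Finset ι) : Measurable (ext S) := by
    refine measurable_pi_lambda _ fun i => ?_
    by_cases h : i ∈ S
    · simp only [ext, h, dif_pos]; exact measurable_pi_apply _
    · simp only [ext, h, dif_neg, not_false_eq_true]; exact measurable_const
  have h := (hind.indepFun_finset S T hST hm).comp (hF.comp (hext S)) (hG.comp (hext T))
  convert h using 1
  · ext ω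
    refine hFS fun i hi => ?_
    have : i ∈ S := hi
    simp [ext, this]
  · ext ω
    refine hGT fun i hi => ?_
    have : i ∈ T := hi
    simp [ext, this]

/-- The characteristic function of a sum of functions of the block sums over disjoint blocks. -/
theorem charFun_sum_comp_blockSum {ι β : Type*} {Y : ι → Ω → ℝ} [IsProbabilityMeasure P]
    (hm : ∀ p, Measurable (Y p)) (hind : iIndepFun Y P) {f : β → Finset ι}
    (hf : Pairwise fun a b => Disjoint (f a) (f b)) {g : ℝ → ℝ} (hg : Measurable g) (s : Finset β)
    (t : ℝ) :
    charFun (P.map fun ω => ∑ b ∈ s, g (∑ p ∈ f b, Y p ω)) t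
      = ∏ b ∈ s, charFun (P.map fun ω => g (∑ p ∈ f b, Y p ω)) t := by
  classical
  have hblock (b : β) : Measurable fun y : ι → ℝ => g (∑ p ∈ f b, y p) := by fun_prop
  have hYm : Measurable fun ω p => Y p ω := measurable_pi_lambda _ hm
  induction s using Finset.induction_on with
  | empty => simp
  | insert a s ha ih =>
    have hi : IndepFun (fun ω => g (∑ p ∈ f a, Y p ω))
        (fun ω => ∑ b ∈ s, g (∑ p ∈ f b, Y p ω)) P := by
      refine indepFun_of_dependsOn hm hind (S := f a) (T := s.biUnion f)
        (F := fun y => g (∑ p ∈ f a, y p)) (G := fun y => ∑ b ∈ s, g (∑ p ∈ f b, y p)) ?_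
        (hblock a) (Finset.measurable_fun_sum _ fun b _ => hblock b) ?_ ?_
      · rw [Finset.disjoint_biUnion_right]
        exact fun b hb => hf fun h => ha (h ▸ hb)
      · intro x y hxy
        simp only
        rw [Finset.sum_congr rfl fun p hp => hxy p hp]
      · intro x y hxy
        refine Finset.sum_congr rfl fun b hb => ?_
        rw [Finset.sum_congr rfl fun p hp => hxy p (Finset.mem_biUnion.2 ⟨b, hb, hp⟩)]
    simp only [Finset.sum_insert ha, Finset.prod_insert ha]
    rw [← ih]
    have := hi.charFun_map_fun_add_eq_mul ((hblock a).comp hYm).aemeasurable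
      (Finset.measurable_fun_sum s fun b _ => (hblock b).comp hYm).aemeasurable
    exact congrFun this t

/-- Sums of iid random variables over index sets of the same size have the same law. -/
lemma map_sum_eq_of_card_eq {ι : Type*} {Y : ι → Ω → ℝ} [IsProbabilityMeasure P]
    (hm : ∀ p, Measurable (Y p)) (hind : iIndepFun Y P) {ν : Measure ℝ}
    (hν : ∀ p, P.map (Y p) = ν) {s t : Finset ι} (hst : s.card = t.card) :
    P.map (fun ω => ∑ p ∈ s, Y p ω) = P.map (fun ω => ∑ p ∈ t, Y p ω) := by
  have key (s : Finset ι) :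
      charFun (P.map (fun ω => ∑ p ∈ s, Y p ω)) = charFun ν ^ s.card := by
    rw [(hind.restrict _).charFun_map_fun_finsetSum_eq_prod (fun p _ => (hm p).aemeasurable)]
    simp [hν]
  have (s : Finset ι) : IsProbabilityMeasure (P.map (fun ω => ∑ p ∈ s, Y p ω)) :=
    Measure.isProbabilityMeasure_map (Finset.measurable_fun_sum _ fun p _ => hm p).aemeasurable
  exact Measure.ext_of_charFun (by rw [key, key, hst])

/-- The centred and normalized square of the sum of `Y` over `s`. -/
noncomputable def sqDev {ι : Type*} (Y : ι → Ω → ℝ) (σ : ℝ) (s : Finset ι) (ω : Ω) : ℝ :=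
  ((∑ p ∈ s, Y p ω) ^ 2 / (s.card * σ ^ 2) - 1) / √2

/-- An iid family with mean zero, variance `σ ^ 2` and finite fourth moment `κ`. -/
structure IsIIDNoise {ι : Type*} (P : Measure Ω) (Y : ι → Ω → ℝ) (σ κ : ℝ) : Prop where
  measurable : ∀ p, Measurable (Y p)
  indep : iIndepFun Y P
  ident : ∀ p q, IdentDistrib (Y p) (Y q) P P
  memLp : ∀ p, MemLp (Y p) 4 P
  mean : ∀ p, ∫ ω, Y p ω ∂P = 0
  sq : ∀ p, ∫ ω, Y p ω ^ 2 ∂P = σ ^ 2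
  four : ∀ p, ∫ ω, Y p ω ^ 4 ∂P = κ

namespace IsIIDNoise

variable {ι : Type*} {Y : ι → Ω → ℝ} {σ κ : ℝ}

lemma measurable_sqDev (h : IsIIDNoise P Y σ κ) (s : Finset ι) : Measurable (sqDev Y σ s) := by
  have := h.measurable
  unfold sqDev
  fun_prop

variable [IsProbabilityMeasure P]

/-- For a fixed cardinality, `sqDev` is a fixed function of the sum, whose law depends only on the
number of summands. The index `p₀` only names the common law of the `Y p`. -/
lemma map_sqDev_eq (h : IsIIDNoise P Y σ κ) (p₀ : ι) {s t : Finset ι} (hst : s.card = t.card) :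
    P.map (sqDev Y σ s) = P.map (sqDev Y σ t) := by
  have hg : Measurable fun x : ℝ => (x ^ 2 / (t.card * σ ^ 2) - 1) / √2 := by fun_prop
  have hS (s : Finset ι) : Measurable fun ω => ∑ p ∈ s, Y p ω :=
    Finset.measurable_fun_sum _ fun p _ => h.measurable p
  have e1 : sqDev Y σ s
      = (fun x : ℝ => (x ^ 2 / (t.card * σ ^ 2) - 1) / √2) ∘ fun ω => ∑ p ∈ s, Y p ω := by
    ext ω; simp [sqDev, hst]
  have e2 : sqDev Y σ t
      = (fun x : ℝ => (x ^ 2 / (t.card * σ ^ 2) - 1) / √2) ∘ fun ω => ∑ p ∈ t, Y p ω := by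
    ext ω; simp [sqDev]
  rw [e1, e2, ← Measure.map_map hg (hS s), ← Measure.map_map hg (hS t),
    map_sum_eq_of_card_eq h.measurable h.indep (fun p => (h.ident p p₀).map_eq) hst]

/-- The factor `√2` normalizes because `Z²` has variance `2`; the excess kurtosis of the noise
survives only at order `1 / s.card`. -/
lemma moments_sqDev (h : IsIIDNoise P Y σ κ) (hσ : 0 < σ) (s : Finset ι) :
    MemLp (sqDev Y σ s) 2 P ∧ (s.Nonempty → ∫ ω, sqDev Y σ s ω ∂P = 0 ∧
      ∫ ω, sqDev Y σ s ω ^ 2 ∂P = 1 + (κ / σ ^ 4 - 3) / 2 * (s.card : ℝ)⁻¹) := by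
  obtain ⟨i0, -, i2, i4⟩ := moments_sum h.measurable h.indep h.memLp h.mean h.sq h.four s
  have j2 : Integrable (fun ω => (∑ p ∈ s, Y p ω) ^ 2) P :=
    MemLp.integrable_pow_of_le (n := 4) i0 (by norm_num)
  have j4 : Integrable (fun ω => (∑ p ∈ s, Y p ω) ^ 4) P :=
    MemLp.integrable_pow_of_le (n := 4) i0 le_rfl
  set c : ℝ := s.card * σ ^ 2 with hc
  have e2 : ∀ ω, sqDev Y σ s ω ^ 2
      = (c ^ 2)⁻¹ / 2 * (∑ p ∈ s, Y p ω) ^ 4 - c⁻¹ * (∑ p ∈ s, Y p ω) ^ 2 + 1 / 2 := by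
    intro ω
    rw [sqDev, div_pow, Real.sq_sqrt (by norm_num)]
    ring
  have e1 : ∀ ω, sqDev Y σ s ω = c⁻¹ / √2 * (∑ p ∈ s, Y p ω) ^ 2 - 1 / √2 := by
    intro ω
    rw [sqDev]
    ring
  have j42 : Integrable (fun ω => (c ^ 2)⁻¹ / 2 * (∑ p ∈ s, Y p ω) ^ 4
      - c⁻¹ * (∑ p ∈ s, Y p ω) ^ 2) P := (j4.const_mul _).sub (j2.const_mul _)
  have hint : Integrable (fun ω => sqDev Y σ s ω ^ 2) P := by
    simp_rw [e2]
    exact j42.add (integrable_const _)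
  refine ⟨(memLp_two_iff_integrable_sq (h.measurable_sqDev s).aestronglyMeasurable).2 hint,
    fun hs => ?_⟩
  have hL : (0 : ℝ) < s.card := by exact_mod_cast hs.card_pos
  constructor
  · simp_rw [e1]
    rw [integral_sub (j2.const_mul _) (integrable_const _), integral_const_mul, i2]
    simp only [integral_const, probReal_univ, one_smul]
    rw [hc]
    field_simp
    ring
  · simp_rw [e2]
    rw [integral_add j42 (integrable_const _),
      integral_sub (j4.const_mul _) (j2.const_mul _), integral_const_mul, integral_const_mul,
      i2, i4]
    simp only [integral_const, probReal_univ, one_smul]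
    rw [hc]
    field_simp
    ring

/-- The classical central limit theorem along the indices `e 0, e 1, …`, followed by the continuous
map `x ↦ (x² - 1) / √2`. -/
lemma tendstoInDistribution_sqDev (h : IsIIDNoise P Y σ κ) (hσ : 0 < σ) (e : ℕ ↪ ι) :
    TendstoInDistribution (fun L : ℕ => sqDev Y σ ((Finset.range L).map e)) atTop
      (fun x : ℝ => (x ^ 2 - 1) / √2) (fun _ => P) (gaussianReal 0 1) := by
  have hclt := tendstoInDistribution_inv_sqrt_mul_sum (P := P)
    (X := fun n ω => Y (e n) ω / σ) (Y := (id : ℝ → ℝ)) (P' := gaussianReal 0 1)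
    ⟨aemeasurable_id, Measure.map_id⟩
    (by simp [integral_div, h.mean])
    (by
      simp only [Pi.pow_apply, div_pow]
      rw [integral_div, h.sq, div_self (by positivity)])
    ((h.indep.precomp e.injective).comp (fun _ x => x / σ) (by fun_prop))
    (fun i => (h.ident (e i) (e 0)).comp (u := fun x => x / σ) (by fun_prop))
  have := hclt.continuous_comp (g := fun x => (x ^ 2 - 1) / √2) (by fun_prop)
  simp only [Function.comp_id] at this
  convert this using 1
  ext L ω
  simp only [sqDev, Function.comp_apply, Finset.sum_map, Finset.card_map, Finset.card_range]
  rw [← Finset.sum_div, mul_pow, inv_pow, Real.sq_sqrt (by positivity)]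
  ring

/-- The central limit theorem for the sum of the normalized squares of block sums, where both the
number of blocks and the block sizes tend to infinity. -/
theorem tendstoInDistribution_sum_sqDev (h : IsIIDNoise P Y σ κ) (hσ : 0 < σ) (e : ℕ ↪ ι)
    {τ β : Type*} {l : Filter τ} [l.IsCountablyGenerated] {f : τ → β → Finset ι}
    (hf : ∀ q, Pairwise fun a b => Disjoint (f q a) (f q b)) {L : τ → ℕ}
    (hcard : ∀ q b, (f q b).card = L q) {s : τ → Finset β} (hL : Tendsto L l atTop)
    (hs : Tendsto (fun q => (s q).card) l atTop) :
    TendstoInDistribution (fun q ω => (√(s q).card)⁻¹ * ∑ b ∈ s q, sqDev Y σ (f q b) ω) l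
      (id : ℝ → ℝ) (fun _ => P) (gaussianReal 0 1) := by
  have hm (q) : Measurable fun ω => ∑ b ∈ s q, sqDev Y σ (f q b) ω :=
    Finset.measurable_fun_sum _ fun b _ => h.measurable_sqDev _
  -- Every block has the law of this reference variable over the first `L q` indices of `e`, so
  -- limits in `L` apply to moving blocks.
  set W : τ → Ω → ℝ := fun q => sqDev Y σ ((Finset.range (L q)).map e) with hW
  have hcardW (q) : ((Finset.range (L q)).map e).card = L q := by simp
  have hW2 (q) : MemLp (W q) 2 P := (h.moments_sqDev hσ _).1
  have hne : ∀ᶠ q in l, ((Finset.range (L q)).map e).Nonempty := by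
    filter_upwards [hL.eventually_ge_atTop 1] with q hq
    rw [← Finset.card_pos, hcardW]; exact hq
  have hmean : ∀ᶠ q in l, ∫ ω, W q ω ∂P = 0 := hne.mono fun q hq => ((h.moments_sqDev hσ _).2 hq).1
  have hsq : Tendsto (fun q => ∫ ω, W q ω ^ 2 ∂P) l (𝓝 1) := by
    have h1 := ((tendsto_inv_atTop_zero.comp (tendsto_natCast_atTop_atTop.comp hL)).const_mul
      ((κ / σ ^ 4 - 3) / 2)).const_add 1
    simp only [mul_zero, add_zero] at h1
    refine h1.congr' (hne.mono fun q hq => ?_)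
    simp only [hW, ((h.moments_sqDev hσ _).2 hq).2, hcardW, Function.comp_apply]
  have hW_lim : TendstoInDistribution W l (fun x : ℝ => (x ^ 2 - 1) / √2) (fun _ => P)
      (gaussianReal 0 1) :=
    ⟨fun q => (h.measurable_sqDev _).aemeasurable, by fun_prop,
      (h.tendstoInDistribution_sqDev hσ e).tendsto.comp hL⟩
  have g4 : MemLp (fun x : ℝ => x) 4 (gaussianReal 0 1) := memLp_id_gaussianReal 4
  have k4 : Integrable (fun x : ℝ => x ^ 4) (gaussianReal 0 1) :=
    MemLp.integrable_pow_of_le (n := 4) g4 le_rfl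
  have k2 : Integrable (fun x : ℝ => x ^ 2) (gaussianReal 0 1) :=
    MemLp.integrable_pow_of_le (n := 4) g4 (by norm_num)
  have ez : ∀ x : ℝ, ((x ^ 2 - 1) / √2) ^ 2 = 1 / 2 * x ^ 4 - x ^ 2 + 1 / 2 := fun x => by
    rw [div_pow, Real.sq_sqrt (by norm_num)]; ring
  have k42 : Integrable (fun x : ℝ => 1 / 2 * x ^ 4 - x ^ 2) (gaussianReal 0 1) :=
    (k4.const_mul _).sub k2
  have hZ2 : MemLp (fun x : ℝ => (x ^ 2 - 1) / √2) 2 (gaussianReal 0 1) := by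
    refine (memLp_two_iff_integrable_sq (by fun_prop)).2 ?_
    simp_rw [ez]
    exact k42.add (integrable_const _)
  have hZsq : ∫ x : ℝ, ((x ^ 2 - 1) / √2) ^ 2 ∂(gaussianReal 0 1) = 1 := by
    simp_rw [ez]
    rw [integral_add k42 (integrable_const _),
      integral_sub (k4.const_mul _) k2, integral_const_mul, integral_pow_four_gaussianReal,
      integral_sq_gaussianReal]
    simp
    norm_num
  have hB : Tendsto (fun q => (√((s q).card : ℝ))⁻¹) l (𝓝 0) :=
    tendsto_inv_atTop_zero.comp
      (Real.tendsto_sqrt_atTop.comp (tendsto_natCast_atTop_atTop.comp hs))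
  have hLind := tendsto_integral_sq_mul_min hW_lim hW2 hZ2 (by rwa [hZsq]) hB
  have hchar (t : ℝ) := tendsto_charFun_pow_of_lindeberg hW2 hmean hsq hs hLind t
  have hcf (q : τ) (t : ℝ) :
      charFun (P.map fun ω => (√(s q).card)⁻¹ * ∑ b ∈ s q, sqDev Y σ (f q b) ω) t
        = charFun (P.map (W q)) ((√(s q).card)⁻¹ * t) ^ (s q).card := by
    rw [charFun_map_mul_comp (hm q).aemeasurable]
    have e1 := charFun_sum_comp_blockSum h.measurable h.indep (hf q)
      (g := fun x => (x ^ 2 / (L q * σ ^ 2) - 1) / √2) (by fun_prop) (s q) ((√(s q).card)⁻¹ * t)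
    have e2 (b : β) : (fun ω => ((∑ p ∈ f q b, Y p ω) ^ 2 / (L q * σ ^ 2) - 1) / √2)
        = sqDev Y σ (f q b) := by
      ext ω; simp [sqDev, hcard]
    have e3 (ω : Ω) : ∑ b ∈ s q, ((∑ p ∈ f q b, Y p ω) ^ 2 / (L q * σ ^ 2) - 1) / √2
        = ∑ b ∈ s q, sqDev Y σ (f q b) ω := by
      simp [sqDev, hcard]
    simp only [e2, e3] at e1
    rw [e1, Finset.prod_congr rfl fun b _ => by
      rw [h.map_sqDev_eq (e 0) ((hcard q b).trans (hcardW q).symm)], Finset.prod_const]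
  refine ⟨fun q => ((hm q).const_mul _).aemeasurable, aemeasurable_id, ?_⟩
  -- Lévy's continuity theorem is applied along sequences, which suffice since `l` is countably
  -- generated.
  refine tendsto_of_seq_tendsto fun u hu => ?_
  refine ProbabilityMeasure.tendsto_iff_tendsto_charFun.2 fun t => ?_
  have := (hchar t).comp hu
  simp only [Function.comp_def, ← hcf] at this
  have e0 : charFun ((gaussianReal 0 1).map id) t = Complex.exp (-(t ^ 2 / 2 : ℝ)) := by
    rw [Measure.map_id, charFun_gaussianReal]
    simp
  rw [← e0] at this
  exact this

end IsIIDNoise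

end BlockTest

/-! ### Convergence and boundedness in probability -/

namespace BlockTest

section Probability

variable {Ω : Type*} [MeasurableSpace Ω] {P : Measure Ω} {τ : Type*} {l : Filter τ}

lemma TendstoInMeasure.comp_continuousAt_const {X : τ → Ω → ℝ} {c : ℝ}
    (hX : TendstoInMeasure P X l fun _ => c) {φ : ℝ → ℝ} (hφ : ContinuousAt φ c) :
    TendstoInMeasure P (fun q ω => φ (X q ω)) l fun _ => φ c := by
  rw [tendstoInMeasure_iff_dist] at hX ⊢
  intro ε hε
  obtain ⟨δ, hδ, h⟩ := Metric.continuousAt_iff.1 hφ ε hε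
  refine tendsto_of_tendsto_of_tendsto_of_le_of_le tendsto_const_nhds (hX δ hδ)
    (fun _ => zero_le) fun q => measure_mono fun ω hω => ?_
  by_contra hlt
  exact absurd (h (not_le.1 hlt)) (not_lt.2 hω)

lemma tendstoInMeasure_of_tendsto_zero {c : τ → ℝ} (hc : Tendsto c l (𝓝 0)) :
    TendstoInMeasure P (fun q (_ : Ω) => c q) l fun _ => 0 := by
  rw [tendstoInMeasure_iff_dist]
  intro δ hδ
  refine tendsto_const_nhds.congr' ?_
  filter_upwards [Metric.tendsto_nhds.1 hc δ hδ] with q hq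
  simp only [not_le.2 hq, Set.ofPred_false, measure_empty]

lemma TendstoInMeasure.add_zero_limits {X Z : τ → Ω → ℝ}
    (hX : TendstoInMeasure P X l fun _ => 0) (hZ : TendstoInMeasure P Z l fun _ => 0) :
    TendstoInMeasure P (fun q ω => X q ω + Z q ω) l fun _ => 0 := by
  rw [tendstoInMeasure_iff_norm] at hX hZ ⊢
  intro ε hε
  have h := (hX (ε / 2) (by positivity)).add (hZ (ε / 2) (by positivity))
  rw [add_zero] at h
  refine tendsto_of_tendsto_of_tendsto_of_le_of_le tendsto_const_nhds h
    (fun _ => zero_le) fun q => (measure_mono fun ω hω => ?_).trans (measure_union_le _ _)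
  simp only [Set.mem_union, Set.mem_ofPred_eq, sub_zero] at hω ⊢
  by_contra! hc
  linarith [norm_add_le (X q ω) (Z q ω)]

variable [IsProbabilityMeasure P]

/-- Off an event of small probability, `G` is within `1` of its limit and `Z` is at most `M`, so the
product is bounded by a fixed multiple of `|c q|`. -/
lemma tendstoInMeasure_mul_of_boundedInProbability {c : τ → ℝ} (hc : Tendsto c l (𝓝 0))
    {G Z : τ → Ω → ℝ} {g : ℝ} (hG : TendstoInMeasure P G l fun _ => g)
    (hZ : BoundedInProbability P Z l) :
    TendstoInMeasure P (fun q ω => c q * (G q ω * Z q ω)) l fun _ => 0 := by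
  rw [tendstoInMeasure_iff_measureReal_norm] at hG ⊢
  intro ε hε
  rw [Metric.tendsto_nhds]
  intro η hη
  obtain ⟨M, hM⟩ := hZ (η / 3) (by positivity)
  have hc' : Tendsto (fun q => |c q| * ((|g| + 1) * |M|)) l (𝓝 0) := by
    simpa using (hc.abs.mul_const ((|g| + 1) * |M|))
  filter_upwards [hM, hc'.eventually_lt_const hε,
    (hG 1 one_pos).eventually_lt_const (show (0 : ℝ) < η / 3 by positivity)] with q h1 h2 h3
  rw [Real.dist_eq, sub_zero, abs_of_nonneg measureReal_nonneg]
  have hsub : {ω | ε ≤ ‖c q * (G q ω * Z q ω) - 0‖}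
      ⊆ {ω | 1 ≤ ‖G q ω - g‖} ∪ {ω | M < |Z q ω|} := by
    intro ω hω
    simp only [Set.mem_union, Set.mem_ofPred_eq, sub_zero, norm_mul, Real.norm_eq_abs] at hω ⊢
    by_contra! hcon
    have hg : |G q ω| ≤ |g| + 1 := by
      have := abs_sub_abs_le_abs_sub (G q ω) g
      linarith [hcon.1]
    have hz : |Z q ω| ≤ |M| := hcon.2.trans (le_abs_self M)
    have : |c q| * (|G q ω| * |Z q ω|) ≤ |c q| * ((|g| + 1) * |M|) := by gcongr
    linarith
  have := (measureReal_mono (μ := P) hsub).trans (measureReal_union_le _ _)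
  linarith

/-- Markov's inequality; `|C| + 1` keeps the threshold positive. -/
lemma boundedInProbability_of_integral_le {U : τ → Ω → ℝ} (h0 : ∀ q ω, 0 ≤ U q ω)
    (hi : ∀ q, Integrable (U q) P) {C : ℝ} (hC : ∀ q, ∫ ω, U q ω ∂P ≤ C) :
    BoundedInProbability P U l := by
  intro δ hδ
  have hM : 0 < (|C| + 1) / δ := by positivity
  refine ⟨(|C| + 1) / δ, Eventually.of_forall fun q => ?_⟩
  have h1 := mul_meas_ge_le_integral_of_nonneg (ae_of_all P (h0 q)) (hi q) ((|C| + 1) / δ)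
  have h2 : P.real {ω | (|C| + 1) / δ < |U q ω|} ≤ P.real {ω | (|C| + 1) / δ ≤ U q ω} := by
    refine measureReal_mono fun ω hω => ?_
    simp only [Set.mem_ofPred_eq, abs_of_nonneg (h0 q ω)] at hω ⊢
    exact hω.le
  refine h2.trans ?_
  have h3 : (|C| + 1) / δ * P.real {ω | (|C| + 1) / δ ≤ U q ω} ≤ |C| + 1 :=
    h1.trans ((hC q).trans (by linarith [le_abs_self C]))
  rw [div_mul_eq_mul_div, div_le_iff₀ hδ] at h3
  exact le_of_mul_le_mul_left h3 (by positivity)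

end Probability

/-! ### Block lengths and block numbers along the admissible sizes -/

section Sizes

instance (l₁ l₂ : ℕ → ℕ) : (sizesToInfinity l₁ l₂).IsCountablyGenerated := by
  unfold sizesToInfinity
  infer_instance

lemma eventually_sizesToInfinity (l₁ l₂ : ℕ → ℕ) (K : ℕ) :
    ∀ᶠ q in sizesToInfinity l₁ l₂, K ≤ q.1 * q.2 ∧ l₁ q.1 ∣ q.1 ∧ l₂ q.2 ∣ q.2 := by
  have h1 : ∀ᶠ q in sizesToInfinity l₁ l₂, K ≤ q.1 * q.2 :=
    (tendsto_comap.eventually (eventually_ge_atTop K)).filter_mono inf_le_left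
  have h2 : ∀ᶠ q in sizesToInfinity l₁ l₂, l₁ q.1 ∣ q.1 ∧ l₂ q.2 ∣ q.2 :=
    mem_inf_of_right (mem_principal_self _)
  exact h1.and h2

/-- `N → ∞` does not force both `n` and `m` to grow. If `n m > a b`, then `n ≥ a` or `m ≥ b`, so one
factor is large, while divisibility keeps the other at least `1`. -/
lemma tendsto_mul_sizesToInfinity {l₁ l₂ f g : ℕ → ℕ} (hf : Tendsto f atTop atTop)
    (hg : Tendsto g atTop atTop) (hf1 : ∀ n, 0 < n → l₁ n ∣ n → 0 < f n)
    (hg1 : ∀ m, 0 < m → l₂ m ∣ m → 0 < g m) :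
    Tendsto (fun q : ℕ × ℕ => f q.1 * g q.2) (sizesToInfinity l₁ l₂) atTop := by
  rw [tendsto_atTop]
  intro K
  obtain ⟨a, ha⟩ := eventually_atTop.1 (hf.eventually_ge_atTop K)
  obtain ⟨b, hb⟩ := eventually_atTop.1 (hg.eventually_ge_atTop K)
  filter_upwards [eventually_sizesToInfinity l₁ l₂ (a * b + 1)] with q ⟨hq, h1, h2⟩
  have hpos : 0 < q.1 * q.2 := by omega
  have hn : 0 < q.1 := Nat.pos_of_mul_pos_right hpos
  have hm : 0 < q.2 := Nat.pos_of_mul_pos_left hpos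
  have hf' := hf1 _ hn h1
  have hg' := hg1 _ hm h2
  rcases le_or_gt a q.1 with h | h
  · exact (ha _ h).trans (Nat.le_mul_of_pos_right _ hg')
  · have : b ≤ q.2 := by
      by_contra! hlt
      have := Nat.mul_le_mul h.le hlt.le
      omega
    exact (hb _ this).trans (Nat.le_mul_of_pos_left _ hf')

lemma tendsto_blockLength {l : ℕ → ℕ} {s : ℝ} (hs : s ∈ Set.Ioo (1 / 2 : ℝ) 1)
    (hl : (fun n => (l n : ℝ)) ~[atTop] fun n => (n : ℝ) ^ s) : Tendsto l atTop atTop := by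
  have hs0 : 0 < s := by linarith [hs.1]
  exact tendsto_natCast_atTop_iff.1
    (hl.symm.tendsto_atTop ((tendsto_rpow_atTop hs0).comp tendsto_natCast_atTop_atTop))

/-- The real quotient is asymptotic to `n ^ (1 - s)` with `1 - s > 0`, and the natural quotient is
its floor. -/
lemma tendsto_div_blockLength {l : ℕ → ℕ} {s : ℝ} (hs : s ∈ Set.Ioo (1 / 2 : ℝ) 1)
    (hl : (fun n => (l n : ℝ)) ~[atTop] fun n => (n : ℝ) ^ s) :
    Tendsto (fun n => n / l n) atTop atTop := by
  have h1 : (fun n : ℕ => (n : ℝ) / l n) ~[atTop] fun n => (n : ℝ) / (n : ℝ) ^ s :=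
    IsEquivalent.refl.div hl
  have h2 : Tendsto (fun n : ℕ => (n : ℝ) / (n : ℝ) ^ s) atTop atTop := by
    refine ((tendsto_rpow_atTop (show 0 < 1 - s by linarith [hs.2])).comp
      tendsto_natCast_atTop_atTop).congr' ?_
    filter_upwards [eventually_gt_atTop 0] with n hn
    have : (0 : ℝ) < n := by exact_mod_cast hn
    simp [Real.rpow_sub this]
  have h3 := tendsto_nat_floor_atTop.comp (h1.symm.tendsto_atTop h2)
  refine h3.congr fun n => ?_
  simp [Nat.floor_div_eq_div]

end Sizes

/-! ### Blocks of the grid and the exact decomposition -/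

section Algebra

/-- The set of grid points in the block with index `b`, for blocks of size `a × c`. -/
def block (a c : ℕ) (b : ℕ × ℕ) : Finset (ℕ × ℕ) :=
  Finset.Ico (b.1 * a) ((b.1 + 1) * a) ×ˢ Finset.Ico (b.2 * c) ((b.2 + 1) * c)

lemma card_block (a c : ℕ) (b : ℕ × ℕ) : (block a c b).card = a * c := by
  simp [block, Nat.add_mul]

lemma disjoint_Ico_mul {a h k : ℕ} (hk : h ≠ k) :
    Disjoint (Finset.Ico (h * a) ((h + 1) * a)) (Finset.Ico (k * a) ((k + 1) * a)) := by
  wlog hlt : h < k generalizing h k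
  · exact (this hk.symm (lt_of_le_of_ne (not_lt.1 hlt) hk.symm)).symm
  rw [Finset.disjoint_left]
  intro i hi hi'
  rw [Finset.mem_Ico] at hi hi'
  have : (h + 1) * a ≤ k * a := Nat.mul_le_mul_right _ hlt
  omega

lemma pairwise_disjoint_block (a c : ℕ) :
    Pairwise fun b b' => Disjoint (block a c b) (block a c b') := by
  intro b b' hb
  rw [block, block, Finset.disjoint_product]
  by_cases h : b.1 = b'.1
  · exact Or.inr (disjoint_Ico_mul fun h' => hb (Prod.ext h h'))
  · exact Or.inl (disjoint_Ico_mul h)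

lemma sum_range_mul (a b : ℕ) (f : ℕ → ℝ) :
    ∑ i ∈ Finset.range (b * a), f i
      = ∑ h ∈ Finset.range b, ∑ i ∈ Finset.Ico (h * a) ((h + 1) * a), f i := by
  induction b with
  | zero => simp
  | succ b ih =>
    rw [Finset.sum_range_succ, ← ih, Finset.range_eq_Ico, Finset.range_eq_Ico,
      Finset.sum_Ico_consecutive _ (Nat.zero_le _) (Nat.mul_le_mul_right _ (Nat.le_succ b))]

lemma sum_grid_eq_sum_block (a b c d : ℕ) (y : ℕ × ℕ → ℝ) :
    ∑ p ∈ Finset.range (b * a) ×ˢ Finset.range (d * c), y p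
      = ∑ B ∈ Finset.range b ×ˢ Finset.range d, ∑ p ∈ block a c B, y p := by
  simp only [block, Finset.sum_product, sum_range_mul]
  refine Finset.sum_congr rfl fun h _ => ?_
  rw [Finset.sum_comm]

variable {Ω : Type*}

/-- Decomposition of the block statistic into its leading term, a term for the estimation error of
the variance, and a term for the overall mean. -/
lemma varStat_sub_eq {X : ℕ → ℕ → Ω → ℝ} {Y : ℕ × ℕ → Ω → ℝ} {a b c d : ℕ} (ha : 0 < a)
    (hb : 0 < b) (hc : 0 < c) (hd : 0 < d) {σ : ℝ} (hσ : 0 < σ) (s x₀ : ℝ) (ω : Ω)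
    (hX : ∀ i < b * a, ∀ j < d * c, X i j ω = x₀ + Y (i, j) ω) :
    varStat X (b * a) (d * c) a c s ω
      - σ ^ 2 / s ^ 2 * ((√((Finset.range b ×ˢ Finset.range d).card))⁻¹
        * ∑ B ∈ Finset.range b ×ˢ Finset.range d, sqDev Y σ (block a c B) ω)
      = -(√(2 * ((a * c : ℕ) : ℝ)))⁻¹ * ((if s = 0 then -1 / σ ^ 2 else 1 / s ^ 2)
          * (√(((b * a : ℕ) : ℝ) * ((d * c : ℕ) : ℝ)) * (s ^ 2 - σ ^ 2)))
        + ((√(2 * ((b * d : ℕ) : ℝ)))⁻¹ + -(√(2 * ((b * d : ℕ) : ℝ)))⁻¹ * (σ ^ 2 / s ^ 2 *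
          ((∑ p ∈ Finset.range (b * a) ×ˢ Finset.range (d * c), Y p ω) ^ 2
            / (((b * a : ℕ) : ℝ) * ((d * c : ℕ) : ℝ) * σ ^ 2)))) := by
  set S : ℕ × ℕ → ℝ := fun B => ∑ p ∈ block a c B, Y p ω with hS
  set U : ℝ := ∑ B ∈ Finset.range b ×ˢ Finset.range d, S B with hU
  set Q : ℝ := ∑ B ∈ Finset.range b ×ˢ Finset.range d, S B ^ 2 with hQ
  have haR : (0 : ℝ) < a := by exact_mod_cast ha
  have hbR : (0 : ℝ) < b := by exact_mod_cast hb
  have hcR : (0 : ℝ) < c := by exact_mod_cast hc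
  have hdR : (0 : ℝ) < d := by exact_mod_cast hd
  have hcard : (((Finset.range b ×ˢ Finset.range d).card : ℕ) : ℝ) = b * d := by simp
  have hblock : ∀ B ∈ Finset.range b ×ˢ Finset.range d,
      blockMean X a c B.1 B.2 ω = x₀ + S B / (a * c) := by
    intro B hB
    rw [Finset.mem_product, Finset.mem_range, Finset.mem_range] at hB
    have e : ∑ i ∈ Finset.Ico (B.1 * a) ((B.1 + 1) * a),
        ∑ j ∈ Finset.Ico (B.2 * c) ((B.2 + 1) * c), X i j ω
        = ∑ p ∈ block a c B, (x₀ + Y p ω) := by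
      rw [block, Finset.sum_product]
      refine Finset.sum_congr rfl fun i hi => Finset.sum_congr rfl fun j hj => ?_
      rw [Finset.mem_Ico] at hi hj
      exact hX i (hi.2.trans_le (Nat.mul_le_mul_right _ hB.1)) j
        (hj.2.trans_le (Nat.mul_le_mul_right _ hB.2))
    rw [blockMean, e, Finset.sum_add_distrib, Finset.sum_const, card_block, nsmul_eq_mul]
    push_cast
    field_simp
    rfl
  have hover : overallMean X (b * a) (d * c) ω = x₀ + U / (b * a * (d * c)) := by
    have e : ∑ i ∈ Finset.range (b * a), ∑ j ∈ Finset.range (d * c), X i j ω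
        = ∑ p ∈ Finset.range (b * a) ×ˢ Finset.range (d * c), (x₀ + Y p ω) := by
      rw [Finset.sum_product]
      refine Finset.sum_congr rfl fun i hi => Finset.sum_congr rfl fun j hj => ?_
      exact hX i (Finset.mem_range.1 hi) j (Finset.mem_range.1 hj)
    rw [overallMean, e, Finset.sum_add_distrib, Finset.sum_const, sum_grid_eq_sum_block,
      Finset.card_product, Finset.card_range, Finset.card_range, nsmul_eq_mul]
    push_cast
    field_simp
    rfl
  have hmeans : ∑ h ∈ Finset.range b, ∑ k ∈ Finset.range d, blockMean X a c h k ω ^ 2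
      = b * d * x₀ ^ 2 + 2 * x₀ / (a * c) * U + Q / (a * c) ^ 2 := by
    rw [← Finset.sum_product' (f := fun h k => blockMean X a c h k ω ^ 2)]
    have e : ∀ B ∈ Finset.range b ×ˢ Finset.range d, blockMean X a c B.1 B.2 ω ^ 2
        = x₀ ^ 2 + 2 * x₀ / (a * c) * S B + S B ^ 2 / (a * c) ^ 2 := by
      intro B hB
      rw [hblock B hB]
      ring
    rw [Finset.sum_congr rfl e, Finset.sum_add_distrib, Finset.sum_add_distrib,
      ← Finset.mul_sum, ← Finset.sum_div, Finset.sum_const, nsmul_eq_mul, hcard]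
  have hdev : ∑ B ∈ Finset.range b ×ˢ Finset.range d, sqDev Y σ (block a c B) ω
      = (Q / (a * c * σ ^ 2) - b * d) / √2 := by
    simp only [sqDev, card_block]
    rw [← Finset.sum_div, Finset.sum_sub_distrib, ← Finset.sum_div, Finset.sum_const,
      nsmul_eq_mul, hcard]
    push_cast
    ring
  rw [sum_grid_eq_sum_block, hdev, varStat, Nat.mul_div_cancel _ ha, Nat.mul_div_cancel _ hc]
  rw [hmeans, hover, hcard]
  push_cast
  have hp2 : √(2 * ((b : ℝ) * d)) = √2 * √((b : ℝ) * d) := Real.sqrt_mul (by norm_num) _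
  have hw2 : √(2 * ((a : ℝ) * c)) = √2 * √((a : ℝ) * c) := Real.sqrt_mul (by norm_num) _
  have hpw : √((b : ℝ) * a * (d * c)) = √((b : ℝ) * d) * √((a : ℝ) * c) := by
    rw [← Real.sqrt_mul (by positivity)]
    congr 1
    ring
  have hp : √((b : ℝ) * d) ^ 2 = b * d := Real.sq_sqrt (by positivity)
  have hw : √((a : ℝ) * c) ^ 2 = a * c := Real.sq_sqrt (by positivity)
  have hp0 : 0 < √((b : ℝ) * d) := Real.sqrt_pos.2 (by positivity)
  have hw0 : 0 < √((a : ℝ) * c) := Real.sqrt_pos.2 (by positivity)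
  have he0 : 0 < √(2 : ℝ) := Real.sqrt_pos.2 (by norm_num)
  have hbadc : (b : ℝ) * a * (d * c) = (b * d) * (a * c) := by ring
  rw [hp2, hw2, hpw, hbadc, ← hU]
  -- With the roots as free variables `p² = b d`, `w² = a c`, the claim is a rational identity.
  clear_value S U Q
  generalize √((b : ℝ) * d) = p at *
  generalize √((a : ℝ) * c) = w at *
  generalize √(2 : ℝ) = e at *
  rw [← hp, ← hw]
  -- At `s = 0` division by zero gives `0`, so the left side is `(1 - B) / √(2B)` with `B = b d`.
  -- The value `-1 / σ²` is chosen to make the right side agree.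
  by_cases hs : s = 0
  · simp only [hs, if_true]
    field_simp
    ring
  · simp only [hs, if_false]
    field_simp
    ring

end Algebra

end BlockTest

/-! ### Assembly of the limit theorem -/

namespace BlockTest

variable {Ω : Type*} [MeasurableSpace Ω] {P : Measure Ω} [IsProbabilityMeasure P]

lemma isIIDNoise_of_moment {ι : Type*} {Y : ι → Ω → ℝ} {p₀ : ι} (hYm : ∀ p, Measurable (Y p))
    (hYindep : iIndepFun Y P) (hYident : ∀ p, IdentDistrib (Y p) (Y p₀) P P) {σ : ℝ}
    (hYmean : ∫ ω, Y p₀ ω ∂P = 0) (hYvar : variance (Y p₀) P = σ ^ 2) {ε : ℝ} (hε : 0 < ε)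
    (hYmoment : Integrable (fun ω => |Y p₀ ω| ^ (4 + ε)) P) :
    IsIIDNoise P Y σ (∫ ω, Y p₀ ω ^ 4 ∂P) := by
  have h4 : MemLp (Y p₀) 4 P := by
    have h : MemLp (Y p₀) (ENNReal.ofReal (4 + ε)) P := by
      rw [← integrable_norm_rpow_iff (hYm p₀).aestronglyMeasurable
        (by simp; linarith) ENNReal.ofReal_ne_top, ENNReal.toReal_ofReal (by linarith)]
      exact hYmoment
    refine h.mono_exponent ?_
    rw [show (4 : ℝ≥0∞) = ENNReal.ofReal 4 by simp]
    exact ENNReal.ofReal_le_ofReal (by linarith)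
  refine ⟨hYm, hYindep, fun p q => (hYident p).trans (hYident q).symm,
    fun p => (hYident p).memLp_iff.2 h4, fun p => (hYident p).integral_eq.trans hYmean,
    fun p => ?_, fun p => ?_⟩
  · have h2 : ∫ ω, Y p ω ^ 2 ∂P = ∫ ω, Y p₀ ω ^ 2 ∂P :=
      ((hYident p).comp (u := fun x => x ^ 2) (by fun_prop)).integral_eq
    rw [h2, ← hYvar, variance_eq_integral (hYm p₀).aemeasurable, hYmean]
    simp
  · exact ((hYident p).comp (u := fun x => x ^ 4) (by fun_prop)).integral_eq

lemma measurable_varStat {X : ℕ → ℕ → Ω → ℝ} (hX : ∀ i j, Measurable (X i j)) (n m a c : ℕ)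
    {s : Ω → ℝ} (hs : Measurable s) : Measurable fun ω => varStat X n m a c (s ω) ω := by
  unfold varStat blockMean overallMean
  fun_prop

/-- An inequality, since the quotient is `0 / 0 = 0` for empty `s`; this lets it hold for all grid
sizes. -/
lemma IsIIDNoise.integral_sum_sq_div_le_one {ι : Type*} {Y : ι → Ω → ℝ} {σ κ : ℝ}
    (h : IsIIDNoise P Y σ κ) (s : Finset ι) :
    Integrable (fun ω => (∑ p ∈ s, Y p ω) ^ 2 / (s.card * σ ^ 2)) P ∧
      ∫ ω, (∑ p ∈ s, Y p ω) ^ 2 / (s.card * σ ^ 2) ∂P ≤ 1 := by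
  obtain ⟨i0, -, i2, -⟩ := moments_sum h.measurable h.indep h.memLp h.mean h.sq h.four s
  refine ⟨(MemLp.integrable_pow_of_le (n := 4) i0 (by norm_num)).div_const _, ?_⟩
  rw [integral_div, i2]
  exact div_self_le_one _

lemma IsIIDNoise.tendstoInDistribution_sum_sqDev_block {Y : ℕ × ℕ → Ω → ℝ} {σ κ : ℝ}
    (h : IsIIDNoise P Y σ κ) (hσ : 0 < σ) {τ : Type*} {l : Filter τ} [l.IsCountablyGenerated]
    {a b c d : τ → ℕ} (hL : Tendsto (fun q => a q * c q) l atTop)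
    (hB : Tendsto (fun q => b q * d q) l atTop) :
    TendstoInDistribution (fun q ω => (√(Finset.range (b q) ×ˢ Finset.range (d q)).card)⁻¹ *
        ∑ B ∈ Finset.range (b q) ×ˢ Finset.range (d q), sqDev Y σ (block (a q) (c q) B) ω) l
      (id : ℝ → ℝ) (fun _ => P) (gaussianReal 0 1) := by
  have hcard (q : τ) : (Finset.range (b q) ×ˢ Finset.range (d q)).card = b q * d q := by simp
  simp only [← hcard] at hB
  exact h.tendstoInDistribution_sum_sqDev hσ ⟨fun i => (i, 0), fun i j h => (Prod.mk.inj h).1⟩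
    (fun q => pairwise_disjoint_block (a q) (c q)) (fun q b => card_block (a q) (c q) b) hL hB

end BlockTest

open BlockTest

theorem mainTheorem1 {Ω : Type*} [MeasurableSpace Ω] (P : Measure Ω) [IsProbabilityMeasure P]
    -- the location function is constant on the unit square
    (μ : ℝ → ℝ → ℝ)
    (hμ : ∃ c : ℝ, ∀ x ∈ Set.Icc (0 : ℝ) 1, ∀ y ∈ Set.Icc (0 : ℝ) 1, μ x y = c)
    -- iid centred noise with variance `σ ^ 2` and a finite absolute moment of order `4 + ε`
    (Y : ℕ × ℕ → Ω → ℝ) (hYm : ∀ p, Measurable (Y p))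
    (hYindep : iIndepFun Y P) (hYident : ∀ p, IdentDistrib (Y p) (Y (0, 0)) P P)
    (σ : ℝ) (hσ : 0 < σ)
    (hYmean : ∫ ω, Y (0, 0) ω ∂P = 0) (hYvar : variance (Y (0, 0)) P = σ ^ 2)
    (ε : ℝ) (hε : 0 < ε) (hYmoment : Integrable (fun ω => |Y (0, 0) ω| ^ (4 + ε)) P)
    -- block lengths of order `n ^ s₁` and `m ^ s₂`
    (s₁ s₂ : ℝ) (hs₁ : s₁ ∈ Set.Ioo (1 / 2 : ℝ) 1) (hs₂ : s₂ ∈ Set.Ioo (1 / 2 : ℝ) 1)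
    (l₁ l₂ : ℕ → ℕ)
    (hl₁ : (fun n => (l₁ n : ℝ)) ~[atTop] (fun n => (n : ℝ) ^ s₁))
    (hl₂ : (fun m => (l₂ m : ℝ)) ~[atTop] (fun m => (m : ℝ) ^ s₂))
    -- `σ'` is a weakly consistent estimator of `σ`, and `σ' ^ 2 - σ ^ 2 = O_P(N ^ (-1 / 2))`
    (σ' : ℕ × ℕ → Ω → ℝ) (hσ'm : ∀ q, Measurable (σ' q))
    (hcons : TendstoInMeasure P σ' (BlockTest.sizesToInfinity l₁ l₂) (fun _ => σ))
    (hrate : BlockTest.BoundedInProbability P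
      (fun q ω => √((q.1 : ℝ) * q.2) * (σ' q ω ^ 2 - σ ^ 2)) (BlockTest.sizesToInfinity l₁ l₂)) :
    TendstoInDistribution
      (fun (q : ℕ × ℕ) ω => BlockTest.varStat (BlockTest.obs μ Y q.1 q.2)
        q.1 q.2 (l₁ q.1) (l₂ q.2) (σ' q ω) ω)
      (BlockTest.sizesToInfinity l₁ l₂) (id : ℝ → ℝ) (fun _ => P) (gaussianReal 0 1) := by
  obtain ⟨x₀, hx₀⟩ := hμ
  have hN := isIIDNoise_of_moment hYm hYindep hYident hYmean hYvar hε hYmoment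
  set F := sizesToInfinity l₁ l₂
  have hl₁' := tendsto_blockLength hs₁ hl₁
  have hl₂' := tendsto_blockLength hs₂ hl₂
  have hL : Tendsto (fun q : ℕ × ℕ => l₁ q.1 * l₂ q.2) F atTop :=
    tendsto_mul_sizesToInfinity hl₁' hl₂' (fun n hn h => Nat.pos_of_dvd_of_pos h hn)
      (fun n hn h => Nat.pos_of_dvd_of_pos h hn)
  have hB : Tendsto (fun q : ℕ × ℕ => (q.1 / l₁ q.1) * (q.2 / l₂ q.2)) F atTop :=
    tendsto_mul_sizesToInfinity (tendsto_div_blockLength hs₁ hl₁) (tendsto_div_blockLength hs₂ hl₂)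
      (fun n hn h => Nat.div_pos (Nat.le_of_dvd hn h) (Nat.pos_of_dvd_of_pos h hn))
      (fun n hn h => Nat.div_pos (Nat.le_of_dvd hn h) (Nat.pos_of_dvd_of_pos h hn))
  have hinv {f : ℕ × ℕ → ℕ} (hf : Tendsto f F atTop) :
      Tendsto (fun q => (√(2 * (f q : ℝ)))⁻¹) F (𝓝 0) :=
    tendsto_inv_atTop_zero.comp (Real.tendsto_sqrt_atTop.comp
      ((tendsto_natCast_atTop_atTop.comp hf).const_mul_atTop two_pos))
  have hneg {f : ℕ × ℕ → ℕ} (hf : Tendsto f F atTop) :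
      Tendsto (fun q => -(√(2 * (f q : ℝ)))⁻¹) F (𝓝 0) := by
    simpa only [neg_zero] using (hinv hf).neg
  have hA := hN.tendstoInDistribution_sum_sqDev_block hσ hL hB
  have hr : TendstoInMeasure P (fun q ω => σ ^ 2 / σ' q ω ^ 2) F fun _ => 1 := by
    have hc : ContinuousAt (fun s : ℝ => σ ^ 2 / s ^ 2) σ :=
      continuousAt_const.div (by fun_prop) (by positivity)
    have := TendstoInMeasure.comp_continuousAt_const hcons hc
    simpa [div_self (pow_ne_zero 2 hσ.ne')] using this
  -- The exceptional value at `0` is harmless: the function agrees with `1 / s²` near `σ > 0`.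
  have hG : TendstoInMeasure P
      (fun q ω => if σ' q ω = 0 then -1 / σ ^ 2 else 1 / σ' q ω ^ 2) F fun _ => 1 / σ ^ 2 := by
    have hc : ContinuousAt (fun s : ℝ => if s = 0 then -1 / σ ^ 2 else 1 / s ^ 2) σ := by
      have h1 : ContinuousAt (fun s : ℝ => 1 / s ^ 2) σ :=
        continuousAt_const.div (by fun_prop) (by positivity)
      refine h1.congr ?_
      filter_upwards [isOpen_ne.mem_nhds hσ.ne'] with s hs
      rw [if_neg hs]
    have := TendstoInMeasure.comp_continuousAt_const hcons hc
    simpa [hσ.ne'] using this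
  let U (q : ℕ × ℕ) (ω : Ω) : ℝ := (∑ p ∈ Finset.range q.1 ×ˢ Finset.range q.2, Y p ω) ^ 2 /
    ((q.1 : ℝ) * q.2 * σ ^ 2)
  have hU : BoundedInProbability P U F := by
    have h (q : ℕ × ℕ) := hN.integral_sum_sq_div_le_one (Finset.range q.1 ×ˢ Finset.range q.2)
    simp only [Finset.card_product, Finset.card_range, Nat.cast_mul] at h
    exact boundedInProbability_of_integral_le (fun q ω => by positivity) (fun q => (h q).1)
      (fun q => (h q).2)
  -- Slutsky: the leading sum is multiplied by a factor tending to `1` in probability.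
  have hmain := hA.continuous_comp_prodMk_of_tendstoInMeasure_const
    (g := fun x : ℝ × ℝ => x.2 * x.1) (by fun_prop) hr
    (fun q => by have := hσ'm q; fun_prop)
  simp only [id, one_mul] at hmain
  refine tendstoInDistribution_of_tendstoInMeasure_sub _ _ hmain ?_ fun q =>
    (measurable_varStat (fun i j => by unfold obs; have := hYm (i, j); fun_prop) _ _ _ _
      (hσ'm q)).aemeasurable
  have hrem := TendstoInMeasure.add_zero_limits
    (tendstoInMeasure_mul_of_boundedInProbability (hneg hL) hG hrate)
    (TendstoInMeasure.add_zero_limits (tendstoInMeasure_of_tendsto_zero (hinv hB))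
      (tendstoInMeasure_mul_of_boundedInProbability (hneg hB) hr hU))
  refine hrem.congr' ?_ (ae_of_all _ fun _ => rfl)
  -- The decomposition needs nonempty grids cut into complete blocks, which holds eventually along
  -- `F`.
  filter_upwards [eventually_sizesToInfinity l₁ l₂ 1] with q ⟨hq, hd₁, hd₂⟩
  refine ae_of_all _ fun ω => ?_
  have hn : 0 < q.1 := Nat.pos_of_mul_pos_right hq
  have hm : 0 < q.2 := Nat.pos_of_mul_pos_left hq
  have ha := Nat.pos_of_dvd_of_pos hd₁ hn
  have hc := Nat.pos_of_dvd_of_pos hd₂ hm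
  have e₁ : q.1 / l₁ q.1 * l₁ q.1 = q.1 := Nat.div_mul_cancel hd₁
  have e₂ : q.2 / l₂ q.2 * l₂ q.2 = q.2 := Nat.div_mul_cancel hd₂
  -- With indices from `0`, the design points `(i + 1) / n` stay in the unit interval, where `μ` is
  -- constant.
  have hunit {i n : ℕ} (hi : i < n) : ((i : ℝ) + 1) / n ∈ Set.Icc (0 : ℝ) 1 := by
    refine ⟨by positivity, div_le_one_of_le₀ ?_ (by positivity)⟩
    exact_mod_cast hi
  have key := varStat_sub_eq (X := obs μ Y q.1 q.2) (Y := Y) ha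
    (Nat.div_pos (Nat.le_of_dvd hn hd₁) ha) hc (Nat.div_pos (Nat.le_of_dvd hm hd₂) hc) hσ
    (σ' q ω) x₀ ω (fun i hi j hj => by
      rw [e₁] at hi
      rw [e₂] at hj
      rw [obs, hx₀ _ (hunit hi) _ (hunit hj)])
  rw [e₁, e₂] at key
  exact key.symm
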